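/- Let $R$ be a commutative noetherian local ring with maximal ideal $\mathfrak m$, and let $\widehat R$ be its $\mathfrak m$-adic completion. A short exact sequence $0\to A\to B\to C\to 0$ of $R$-modules is called pure if $A\otimes_R X\to B\otimes_R X$ is injective for every $R$-module $X$, and an $R$-module $F$ is called pure-projective if $\operatorname{Hom}_R(F,B)\to\operatorname{Hom}_R(F,C)$ is surjective for every pure short exact sequence $0\to A\to B\to C\to 0$ of $R$-modules (equivalently, $F$ is isomorphic to a direct summand of a direct sum of finitely presented $R$-modules). Let $P$ and $Q$ be pure-projective $R$-modules, not necessarily finitely or countably generated. Then $P\cong Q$ as $R$-modules if and only if $P\otimes_R\widehat R\cong Q\otimes_R\widehat R$ as $\widehat R$-modules. -/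

import Mathlib

open scoped TensorProduct

universe u v w

/-- `0 → A → B → C → 0` (with maps `f`, `g`) is a pure exact sequence of `R`-modules: it is a short
exact sequence and `f ⊗ 1_X` is injective for every `R`-module `X`. -/
def IsPureShortExact {R : Type u} [CommRing R] {A B C : Type w}
    [AddCommGroup A] [AddCommGroup B] [AddCommGroup C] [Module R A] [Module R B] [Module R C]
    (f : A →ₗ[R] B) (g : B →ₗ[R] C) : Prop :=
  Function.Injective f ∧ Function.Exact f g ∧ Function.Surjective g ∧
    ∀ (X : Type (max u w)) [AddCommGroup X] [Module R X], Function.Injective (f.rTensor X)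

/-- `P` is pure-projective: `Hom(P, B) → Hom(P, C)` is surjective for every pure exact sequence
`0 → A → B → C → 0`. The sequences range over a universe that contains copies of both `R` and `P`,
so enlarging it further does not change the notion. -/
def IsPureProjective (R : Type u) [CommRing R] (P : Type v) [AddCommGroup P] [Module R P] : Prop :=
  ∀ (A B C : Type (max u v)) [AddCommGroup A] [AddCommGroup B] [AddCommGroup C]
    [Module R A] [Module R B] [Module R C] (f : A →ₗ[R] B) (g : B →ₗ[R] C),
    IsPureShortExact f g → ∀ k : P →ₗ[R] C, ∃ l : P →ₗ[R] B, g ∘ₗ l = k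

/-- The completion of a local ring in the topology of its maximal ideal. -/
abbrev LocalCompletion (R : Type u) [CommRing R] [IsLocalRing R] : Type u :=
  AdicCompletion (IsLocalRing.maximalIdeal R) R

/-!
A pure-projective module is a direct summand of a direct sum of finitely presented modules, since
the canonical map from the sum of all finitely presented modules over `P` is a pure epimorphism.

Let `A` be the completion, so that `A` is flat and `A ⧸ J A = R ⧸ J` for the maximal ideal `J`,
and let `Φ : A ⊗ P ≃ A ⊗ Q`. As `A ⊗ Hom(N, Q) = Hom(A ⊗ N, A ⊗ Q)` for `N` finitely presented,
`Φ` and `Φ⁻¹` are congruent modulo `J` to base changes of maps `f : P → Q` and `g : Q → P`, which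
are then inverse to each other modulo `J`. By Nakayama's lemma `g` can be changed modulo `J` so
that `g ∘ f` fixes a prescribed finitely generated submodule of `P`, and likewise on the side of
`Q`. If `P` and `Q` are countably generated, going back and forth along generators yields an
isomorphism `P ≃ Q`.

In general, as in Kaplansky's theorem, a set of summands of `P` and `Q` that is closed under the
countably many summands reached from each of them through the idempotents, `Φ` and `Φ⁻¹` cuts out
direct summands of `P` and `Q` whose base changes correspond under `Φ`. A well-ordered filtration
by such sets with countable steps splits `P` and `Q` into countably generated modules, and the
base changes of corresponding pieces are isomorphic.
-/

section Purity

open TensorProduct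

variable {R : Type*} [CommRing R] {A B C : Type*} [AddCommGroup A] [AddCommGroup B]
  [AddCommGroup C] [Module R A] [Module R B] [Module R C] {f : A →ₗ[R] B} {g : B →ₗ[R] C}

/-- Every map from a finitely presented module to the codomain of `g` factors through `g`. The
finitely presented modules are taken in the form `R ^ n ⧸ N`, which keeps the definition free of
universe levels. -/
def LiftsFinitelyPresented (g : B →ₗ[R] C) : Prop :=
  ∀ (n : ℕ) (N : Submodule R (Fin n → R)), N.FG →
    ∀ h : ((Fin n → R) ⧸ N) →ₗ[R] C, ∃ l : ((Fin n → R) ⧸ N) →ₗ[R] B, g ∘ₗ l = h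

namespace LiftsFinitelyPresented

theorem surjective (hg : LiftsFinitelyPresented g) : Function.Surjective g := by
  intro c
  obtain ⟨l, hl⟩ := hg 1 ⊥ Submodule.fg_bot
    (Submodule.liftQ _ (LinearMap.toSpanSingleton R C c ∘ₗ LinearMap.proj 0) bot_le)
  refine ⟨l (Submodule.Quotient.mk fun _ ↦ 1), ?_⟩
  rw [← LinearMap.comp_apply, hl]
  simp

theorem equiv_comp {C' : Type*} [AddCommGroup C'] [Module R C'] (hg : LiftsFinitelyPresented g)
    (e : C ≃ₗ[R] C') : LiftsFinitelyPresented (e.toLinearMap ∘ₗ g) := by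
  intro n N hN h
  obtain ⟨l, hl⟩ := hg n N hN (e.symm.toLinearMap ∘ₗ h)
  exact ⟨l, LinearMap.ext fun x ↦ e.symm.injective (by simpa using LinearMap.congr_fun hl x)⟩

/-- If the system is solvable in `B`, its right hand sides are the relations among the images in
`C` of a solution; lifting those relations corrects the solution to one in `A`. -/
theorem exists_solution (hg : LiftsFinitelyPresented g) (hf : Function.Injective f)
    (hfg : Function.Exact f g) {ι : Type*} [Finite ι] {k : ℕ} {c : ι → Fin k → R} {a : ι → A}
    {b : Fin k → B} (hab : ∀ i, f (a i) = ∑ j, c i j • b j) :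
    ∃ a' : Fin k → A, ∀ i, a i = ∑ j, c i j • a' j := by
  let N : Submodule R (Fin k → R) := Submodule.span R (Set.range c)
  have hN : N ≤ (Fintype.linearCombination R (g ∘ b)).ker := by
    rw [Submodule.span_le]
    rintro _ ⟨i, rfl⟩
    simpa [Fintype.linearCombination_apply, hfg.apply_apply_eq_zero] using
      (congrArg g (hab i)).symm
  obtain ⟨l, hl⟩ := hg k N (Submodule.fg_span (Set.finite_range c)) (N.liftQ _ hN)
  let b' : (Fin k → R) →ₗ[R] B := l ∘ₗ N.mkQ
  have hgb' (j : Fin k) : g (b j - b' (Pi.single j 1)) = 0 := by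
    have : g (b' (Pi.single j 1)) = g (b j) := by
      simpa [b'] using LinearMap.congr_fun hl (N.mkQ (Pi.single j 1))
    rw [map_sub, this, sub_self]
  choose a' ha' using fun j ↦ (hfg _).mp (hgb' j)
  refine ⟨a', fun i ↦ hf ?_⟩
  have hb' : ∑ j, c i j • b' (Pi.single j 1) = 0 := by
    have hc : N.mkQ (c i) = 0 := by
      simpa using! Submodule.subset_span (R := R) (Set.mem_range_self (f := c) i)
    simp_rw [← map_smul, ← map_sum]
    rw [← pi_eq_sum_univ' (c i), LinearMap.comp_apply, hc, map_zero]
  simp [ha', smul_sub, Finset.sum_sub_distrib, hb', hab]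

theorem lTensor_injective_of_finite (hg : LiftsFinitelyPresented g) (hf : Function.Injective f)
    (hfg : Function.Exact f g) (X : Type*) [AddCommGroup X] [Module R X] [Module.Finite R X] :
    Function.Injective (f.lTensor X) := by
  rw [injective_iff_map_eq_zero]
  intro t ht
  obtain ⟨k, x, a, rfl⟩ := exists_sum_tmul_eq t
  obtain ⟨n, y, hy⟩ := Module.Finite.exists_fin (R := R) (M := X)
  let x' : Fin k ⊕ Fin n → X := Sum.elim x y
  let a' : Fin k ⊕ Fin n → A := Sum.elim a 0
  have hx' : Submodule.span R (Set.range x') = ⊤ := by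
    simp [x', Set.Sum.elim_range, Submodule.span_union, hy]
  have hsum : ∑ i, x i ⊗ₜ a i = ∑ i, x' i ⊗ₜ[R] a' i := by simp [x', a']
  rw [hsum] at ht ⊢
  obtain ⟨m, c, b, hab, hc⟩ := vanishesTrivially_of_sum_tmul_eq_zero R (n := f ∘ a') hx'
    (by simpa using ht)
  obtain ⟨a'', ha''⟩ := hg.exists_solution hf hfg hab
  exact sum_tmul_eq_zero_of_vanishesTrivially R ⟨m, c, a'', ha'', hc⟩

theorem rTensor_injective (hg : LiftsFinitelyPresented g) (hf : Function.Injective f)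
    (hfg : Function.Exact f g) (X : Type*) [AddCommGroup X] [Module R X] :
    Function.Injective (f.rTensor X) := by
  rw [← LinearMap.lTensor_inj_iff_rTensor_inj, injective_iff_map_eq_zero]
  intro t ht
  obtain ⟨Y, hY, t, rfl⟩ := TensorProduct.exists_of_fg t
  rw [← LinearMap.comp_apply, LinearMap.lTensor_comp_rTensor, ← LinearMap.rTensor_comp_lTensor,
    LinearMap.comp_apply] at ht
  obtain ⟨Z, hYZ, hZ, ht⟩ := TensorProduct.eq_zero_of_fg_of_subtype_eq_zero hY ht
  rw [← LinearMap.comp_apply, LinearMap.rTensor_comp_lTensor, ← LinearMap.lTensor_comp_rTensor,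
    LinearMap.comp_apply] at ht
  have : Module.Finite R Z := Module.Finite.iff_fg.mpr hZ
  have ht' := (injective_iff_map_eq_zero _).mp (hg.lTensor_injective_of_finite hf hfg Z) _ ht
  rw [← Submodule.subtype_comp_inclusion _ _ hYZ, LinearMap.rTensor_comp, LinearMap.comp_apply,
    ht', map_zero]

theorem isPureShortExact {R : Type u} [CommRing R] {B C : Type w} [AddCommGroup B]
    [AddCommGroup C] [Module R B] [Module R C] {g : B →ₗ[R] C} (hg : LiftsFinitelyPresented g) :
    IsPureShortExact g.ker.subtype g :=
  ⟨g.ker.injective_subtype, g.exact_subtype_ker_map, hg.surjective, fun X _ _ ↦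
    hg.rTensor_injective g.ker.injective_subtype g.exact_subtype_ker_map X⟩

end LiftsFinitelyPresented

theorem IsPureProjective.exists_rightInverse {R : Type u} [CommRing R] {P : Type v}
    [AddCommGroup P] [Module R P] (hP : IsPureProjective R P) {B : Type (max u v)}
    [AddCommGroup B] [Module R B] {g : B →ₗ[R] P} (hg : LiftsFinitelyPresented g) :
    ∃ l : P →ₗ[R] B, g ∘ₗ l = LinearMap.id := by
  let e : P ≃ₗ[R] ULift.{u} P := ULift.moduleEquiv.symm
  obtain ⟨l, hl⟩ := hP _ _ _ _ _ (hg.equiv_comp e).isPureShortExact e.toLinearMap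
  exact ⟨l, LinearMap.ext fun x ↦ e.injective (LinearMap.congr_fun hl x)⟩

end Purity

section SumRetract

/-- Maps `coord i : P → M i` and `gen i : M i → P` exhibiting `P` as a direct summand of the direct
sum of the modules `M i`: the identity of `P` is the pointwise finite sum of the composites
`gen i ∘ coord i`. -/
structure SumRetract (R : Type*) [CommRing R] (P : Type*) [AddCommGroup P] [Module R P]
    {I : Type*} (M : I → Type*) [∀ i, AddCommGroup (M i)] [∀ i, Module R (M i)] where
  coord : ∀ i, P →ₗ[R] M i
  gen : ∀ i, M i →ₗ[R] P
  finite_coord_ne_zero : ∀ x, {i | coord i x ≠ 0}.Finite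
  finsum_gen_coord : ∀ x, ∑ᶠ i, gen i (coord i x) = x

namespace SumRetract

variable {R : Type*} [CommRing R] {P Q : Type*} [AddCommGroup P] [Module R P]
  [AddCommGroup Q] [Module R Q] {I : Type*} {M : I → Type*}
  [∀ i, AddCommGroup (M i)] [∀ i, Module R (M i)] (D : SumRetract R P M)

theorem hasFiniteSupport (φ : ∀ i, M i →ₗ[R] Q) (x : P) :
    (fun i ↦ φ i (D.coord i x)).HasFiniteSupport :=
  (D.finite_coord_ne_zero x).subset fun i hi h ↦ hi (by simp [h])

/-- The map out of `P` assembled from maps out of the modules `M i`. -/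
noncomputable def lift (φ : ∀ i, M i →ₗ[R] Q) : P →ₗ[R] Q where
  toFun x := ∑ᶠ i, φ i (D.coord i x)
  map_add' x y := by
    simp_rw [map_add]
    exact finsum_add_distrib (D.hasFiniteSupport φ x) (D.hasFiniteSupport φ y)
  map_smul' c x := by
    simp_rw [map_smul, RingHom.id_apply, smul_finsum' c (D.hasFiniteSupport φ x)]

theorem lift_apply (φ : ∀ i, M i →ₗ[R] Q) (x : P) : D.lift φ x = ∑ᶠ i, φ i (D.coord i x) :=
  rfl

theorem comp_lift {Z : Type*} [AddCommGroup Z] [Module R Z] (ψ : Q →ₗ[R] Z)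
    (φ : ∀ i, M i →ₗ[R] Q) : ψ ∘ₗ D.lift φ = D.lift fun i ↦ ψ ∘ₗ φ i :=
  LinearMap.ext fun x ↦ map_finsum ψ (D.hasFiniteSupport φ x)

theorem lift_comp_gen (ψ : P →ₗ[R] Q) : D.lift (fun i ↦ ψ ∘ₗ D.gen i) = ψ := by
  rw [← D.comp_lift]
  exact LinearMap.ext fun x ↦ congrArg ψ (D.finsum_gen_coord x)

/-- A retract of `P` is a summand of the same direct sum. -/
def retract {K : Type*} [AddCommGroup K] [Module R K] (j : K →ₗ[R] P) (κ : P →ₗ[R] K)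
    (h : κ ∘ₗ j = LinearMap.id) : SumRetract R K M where
  coord i := D.coord i ∘ₗ j
  gen i := κ ∘ₗ D.gen i
  finite_coord_ne_zero x := D.finite_coord_ne_zero (j x)
  finsum_gen_coord x :=
    (LinearMap.congr_fun (D.lift_comp_gen κ) (j x)).trans (LinearMap.congr_fun h x)

theorem finite_baseChange_coord_ne_zero (A : Type*) [CommRing A] [Algebra R A] (z : A ⊗[R] P) :
    {i | (D.coord i).baseChange A z ≠ 0}.Finite := by
  induction z with
  | zero => simp
  | tmul a x => exact (D.finite_coord_ne_zero x).subset fun i hi h ↦ hi (by simp [h])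
  | add y z hy hz =>
    refine (hy.union hz).subset fun i hi ↦ ?_
    contrapose! hi
    simp_all

/-- Extension of scalars of the retraction data. -/
noncomputable def baseChange (A : Type*) [CommRing A] [Algebra R A] :
    SumRetract A (A ⊗[R] P) (fun i ↦ A ⊗[R] M i) where
  coord i := (D.coord i).baseChange A
  gen i := (D.gen i).baseChange A
  finite_coord_ne_zero := D.finite_baseChange_coord_ne_zero A
  finsum_gen_coord z := by
    induction z with
    | zero => simp
    | tmul a x =>
      simp only [LinearMap.baseChange_tmul]
      exact (map_finsum (TensorProduct.mk R A P a) (D.hasFiniteSupport D.gen x)).symm.trans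
        (congrArg (a ⊗ₜ ·) (D.finsum_gen_coord x))
    | add y z hy hz =>
      simp only [map_add]
      rw [finsum_add_distrib, hy, hz]
      · exact (D.finite_baseChange_coord_ne_zero A y).subset fun i hi h ↦ hi (by simp [h])
      · exact (D.finite_baseChange_coord_ne_zero A z).subset fun i hi h ↦ hi (by simp [h])

theorem baseChange_lift (A : Type*) [CommRing A] [Algebra R A] (φ : ∀ i, M i →ₗ[R] Q) :
    (D.lift φ).baseChange A = (D.baseChange A).lift fun i ↦ (φ i).baseChange A := by
  ext x
  simp only [LinearMap.baseChange_tmul, TensorProduct.AlgebraTensorModule.curry_apply,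
    TensorProduct.curry_apply, LinearMap.coe_restrictScalars, lift_apply, baseChange]
  exact map_finsum (TensorProduct.mk R A Q 1) (D.hasFiniteSupport φ x)

/-- The indices of the summands that a map to `P` meets. -/
def support {N : Type*} [AddCommGroup N] [Module R N] (φ : N →ₗ[R] P) : Set I :=
  {i | D.coord i ∘ₗ φ ≠ 0}

theorem finite_support {N : Type*} [AddCommGroup N] [Module R N] [Module.Finite R N]
    (φ : N →ₗ[R] P) : (D.support φ).Finite := by
  obtain ⟨s, hs⟩ := Module.Finite.fg_top (R := R) (M := N)
  refine (s.finite_toSet.biUnion fun x _ ↦ D.finite_coord_ne_zero (φ x)).subset fun i hi ↦ ?_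
  contrapose! hi
  simp only [Set.mem_iUnion, not_exists, Set.mem_ofPred_eq, not_not] at hi
  exact not_not.mpr (LinearMap.ext_on hs fun x hx ↦ hi x hx)

theorem coord_eq_zero_of_notMem_support {N : Type*} [AddCommGroup N] [Module R N] {φ : N →ₗ[R] P}
    {i : I} (hi : i ∉ D.support φ) (x : N) : D.coord i (φ x) = 0 :=
  LinearMap.congr_fun (not_not.mp hi) x

theorem exists_finset_factorization (D : SumRetract R P M) {X : Submodule R P} (hX : X.FG) :
    ∃ (F : Finset I) (r : P →ₗ[R] (∀ i : F, M i)) (e : (∀ i : F, M i) →ₗ[R] P),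
      ∀ x ∈ X, e (r x) = x := by
  have : Module.Finite R X := Module.Finite.iff_fg.mpr hX
  let F := (D.finite_support X.subtype).toFinset
  refine ⟨F, LinearMap.pi fun i ↦ D.coord i, ∑ i : F, D.gen i ∘ₗ LinearMap.proj i,
    fun x hx ↦ ?_⟩
  have hsupp : (fun i ↦ D.gen i (D.coord i x)).support ⊆ F := fun i hi ↦ by
    contrapose! hi
    have := D.coord_eq_zero_of_notMem_support (φ := X.subtype) (by simpa [F] using hi) ⟨x, hx⟩
    simp_all
  calc _ = ∑ i : F, D.gen i (D.coord i x) := by simp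
    _ = ∑ᶠ i, D.gen i (D.coord i x) := by
      rw [finsum_eq_sum_of_support_subset _ hsupp]
      exact Finset.sum_coe_sort F fun i ↦ D.gen i (D.coord i x)
    _ = x := D.finsum_gen_coord x

open Classical in
/-- The retraction data given by a section of a map out of a direct sum. -/
noncomputable def ofSection (gen : ∀ i, M i →ₗ[R] P) (l : P →ₗ[R] DirectSum I M)
    (hl : DirectSum.toModule R I P gen ∘ₗ l = LinearMap.id) : SumRetract R P M where
  coord i := DirectSum.component R I M i ∘ₗ l
  gen := gen
  finite_coord_ne_zero x := DFinsupp.finite_support (l x)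
  finsum_gen_coord x := by
    rw [finsum_eq_sum_of_support_subset (s := DFinsupp.support (l x))]
    · exact (DFinsupp.sumAddHom_apply (fun i ↦ (gen i).toAddMonoidHom) (l x)).symm.trans
        (LinearMap.congr_fun hl x)
    · intro i hi
      contrapose! hi
      have : DirectSum.component R I M i (l x) = 0 :=
        DFinsupp.notMem_support_iff.mp hi
      simp [this]

end SumRetract

/-- A finitely presented module `R ^ rank ⧸ rel` together with a map from it to `P`. -/
structure FinitelyPresentedOver (R : Type u) [CommRing R] (P : Type v) [AddCommGroup P]
    [Module R P] : Type (max u v) where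
  rank : ℕ
  rel : Submodule R (Fin rank → R)
  rel_fg : rel.FG
  hom : ((Fin rank → R) ⧸ rel) →ₗ[R] P

namespace FinitelyPresentedOver

variable {R : Type u} [CommRing R] {P : Type v} [AddCommGroup P] [Module R P]

/-- The finitely presented module itself. -/
abbrev Mod (i : FinitelyPresentedOver R P) : Type u := (Fin i.rank → R) ⧸ i.rel

instance (i : FinitelyPresentedOver R P) : Module.FinitePresentation R i.Mod :=
  Module.finitePresentation_of_surjective i.rel.mkQ i.rel.mkQ_surjective
    (by simpa using i.rel_fg)

open Classical in
theorem liftsFinitelyPresented_toModule :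
    LiftsFinitelyPresented (B := DirectSum (FinitelyPresentedOver R P) Mod)
      (DirectSum.toModule R (FinitelyPresentedOver R P) P hom) :=
  fun n N hN h ↦ ⟨DirectSum.lof R _ Mod ⟨n, N, hN, h⟩, LinearMap.ext
    (DirectSum.toModule_lof R (M := Mod) (φ := hom) (⟨n, N, hN, h⟩ : FinitelyPresentedOver R P))⟩

end FinitelyPresentedOver

theorem IsPureProjective.nonempty_sumRetract {R : Type u} [CommRing R] {P : Type v}
    [AddCommGroup P] [Module R P] (hP : IsPureProjective R P) :
    Nonempty (SumRetract R P (FinitelyPresentedOver.Mod (R := R) (P := P))) :=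
  let ⟨l, hl⟩ := hP.exists_rightInverse FinitelyPresentedOver.liftsFinitelyPresented_toModule
  ⟨.ofSection _ l hl⟩

end SumRetract

section BackAndForth

variable {R : Type*} [CommRing R] {P Q : Type*} [AddCommGroup P] [Module R P] [AddCommGroup Q]
  [Module R Q]

/-- A module with a countable generating set. -/
def IsCountablyGenerated (R : Type*) [CommRing R] (P : Type*) [AddCommGroup P] [Module R P] :
    Prop :=
  ∃ s : Set P, s.Countable ∧ Submodule.span R s = ⊤

open Order in
theorem nonempty_linearEquiv_of_forth_of_back {S : Set (P →ₗ.[R] Q)} (hne : S.Nonempty)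
    (injective : ∀ θ ∈ S, Function.Injective θ)
    (forth : ∀ θ ∈ S, ∀ a, ∃ θ' ∈ S, θ ≤ θ' ∧ a ∈ θ'.domain)
    (back : ∀ θ ∈ S, ∀ b, ∃ θ' ∈ S, θ ≤ θ' ∧ b ∈ Set.range θ')
    (hP : IsCountablyGenerated R P) (hQ : IsCountablyGenerated R Q) : Nonempty (P ≃ₗ[R] Q) := by
  obtain ⟨s, hs, hs'⟩ := hP
  obtain ⟨t, ht, ht'⟩ := hQ
  have := hs.toEncodable
  have := ht.toEncodable
  let 𝒟 : s ⊕ t → Cofinal S := Sum.elim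
    (fun a ↦ ⟨{θ | a.1 ∈ θ.1.domain}, fun θ ↦
      let ⟨θ', hθ', hle, ha⟩ := forth θ θ.2 a; ⟨⟨θ', hθ'⟩, ha, hle⟩⟩)
    (fun b ↦ ⟨{θ | b.1 ∈ Set.range θ.1}, fun θ ↦
      let ⟨θ', hθ', hle, hb⟩ := back θ θ.2 b; ⟨⟨θ', hθ'⟩, hb, hle⟩⟩)
  let G : Ideal S := idealOfCofinals ⟨_, hne.some_mem⟩ 𝒟
  let c : Set (P →ₗ.[R] Q) := Subtype.val '' (G : Set S)
  have hc : DirectedOn (· ≤ ·) c := directedOn_image.mpr G.directed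
  let Θ : P →ₗ.[R] Q := LinearPMap.sSup c hc
  have hinj : Function.Injective Θ := by
    refine (injective_iff_map_eq_zero Θ.toFun).mpr fun x hx ↦ ?_
    obtain ⟨θ, hθ, hxθ⟩ := (LinearPMap.mem_domain_sSup_iff (G.nonempty.image _) hc).mp x.2
    have h0 : θ ⟨x, hxθ⟩ = θ 0 := by
      rw [θ.map_zero, ← hx]
      exact (LinearPMap.sSup_apply hc hθ ⟨x, hxθ⟩).symm
    obtain ⟨θ, -, rfl⟩ := hθ
    exact Subtype.ext (congrArg (fun y : θ.1.domain ↦ (y : P)) (injective _ θ.2 h0))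
  have hdom : Θ.domain = ⊤ := by
    rw [← top_le_iff, ← hs', Submodule.span_le]
    intro a ha
    obtain ⟨θ, haθ, hθ⟩ := cofinal_meets_idealOfCofinals ⟨_, hne.some_mem⟩ 𝒟 (.inl ⟨a, ha⟩)
    exact (LinearPMap.le_sSup hc ⟨θ, hθ, rfl⟩).1 haθ
  have hsurj : Function.Surjective Θ.toFun := by
    rw [← LinearMap.range_eq_top, ← top_le_iff, ← ht', Submodule.span_le]
    intro b hb
    obtain ⟨θ, ⟨x, hx⟩, hθ⟩ := cofinal_meets_idealOfCofinals ⟨_, hne.some_mem⟩ 𝒟 (.inr ⟨b, hb⟩)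
    exact ⟨_, (LinearPMap.sSup_apply hc ⟨θ, hθ, rfl⟩ x).trans hx⟩
  exact ⟨(LinearEquiv.ofTop _ hdom).symm.trans (.ofBijective Θ.toFun ⟨hinj, hsurj⟩)⟩

end BackAndForth

section InverseMod

variable {R : Type*} [CommRing R] {J : Ideal R} {P Q : Type*} [AddCommGroup P] [Module R P]
  [AddCommGroup Q] [Module R Q]

theorem smodEq_map_smul_top {x y : P} (h : x ≡ y [SMOD (J • ⊤ : Submodule R P)]) (f : P →ₗ[R] Q) :
    f x ≡ f y [SMOD (J • ⊤ : Submodule R Q)] :=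
  (h.map f).mono (Submodule.map_le_iff_le_comap.mpr (Submodule.smul_top_le_comap_smul_top J f))

theorem bijective_of_forall_smodEq [Module.Finite R P] (hJ : J ≤ Ideal.jacobson ⊥) {t : P →ₗ[R] P}
    (ht : ∀ x, t x ≡ x [SMOD (J • ⊤ : Submodule R P)]) : Function.Bijective t := by
  apply OrzechProperty.bijective_of_surjective_endomorphism
  rw [← LinearMap.range_eq_top, ← top_le_iff]
  refine Submodule.le_of_le_smul_of_le_jacobson_bot Module.Finite.fg_top hJ fun x _ ↦ ?_
  rw [← sub_sub_cancel (t x) x]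
  exact Submodule.sub_mem_sup (LinearMap.mem_range_self t x) (SModEq.sub_mem.mp (ht x))

/-- Two linear maps are mutually inverse modulo `J`. -/
structure InverseMod (J : Ideal R) (f : P →ₗ[R] Q) (g : Q →ₗ[R] P) : Prop where
  left : ∀ x, g (f x) ≡ x [SMOD (J • ⊤ : Submodule R P)]
  right : ∀ y, f (g y) ≡ y [SMOD (J • ⊤ : Submodule R Q)]

theorem InverseMod.symm {f : P →ₗ[R] Q} {g : Q →ₗ[R] P} (h : InverseMod J f g) :
    InverseMod J g f := ⟨h.right, h.left⟩

variable {I : Type*} {M : I → Type*} [∀ i, AddCommGroup (M i)] [∀ i, Module R (M i)]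
  [∀ i, Module.Finite R (M i)]

/-- If `e ∘ r` fixes `X`, where `e` starts at a finitely generated module, then `h` agrees on `X`
with a map whose conjugate `1 + r ∘ (h - 1) ∘ e` is invertible by Nakayama's lemma. -/
theorem SumRetract.exists_leftInverseOn (D : SumRetract R P M) (hJ : J ≤ Ideal.jacobson ⊥)
    {h : P →ₗ[R] P} (hh : ∀ x, h x ≡ x [SMOD (J • ⊤ : Submodule R P)]) {X : Submodule R P}
    (hX : X.FG) :
    ∃ k : P →ₗ[R] P, (∀ x, k x ≡ x [SMOD (J • ⊤ : Submodule R P)]) ∧ ∀ x ∈ X, k (h x) = x := by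
  obtain ⟨F, r, e, hre⟩ := D.exists_finset_factorization hX
  let t : (∀ i : F, M i) →ₗ[R] (∀ i : F, M i) := LinearMap.id + r ∘ₗ (h - LinearMap.id) ∘ₗ e
  have ht (y) : t y ≡ y [SMOD (J • ⊤ : Submodule R (∀ i : F, M i))] := by
    simpa [t] using SModEq.rfl.add (smodEq_map_smul_top (sub_smodEq_zero.mpr (hh (e y))) r)
  let τ := LinearEquiv.ofBijective t (bijective_of_forall_smodEq hJ ht)
  let k : P →ₗ[R] P := e ∘ₗ τ.symm.toLinearMap ∘ₗ r
  have hk : ∀ x ∈ X, k (h x) = x := by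
    intro x hx
    have htx : t (r x) = r (h x) := by simp [t, hre x hx]
    have hτ : τ.symm (r (h x)) = r x := (LinearEquiv.symm_apply_eq τ).mpr htx.symm
    simp [k, hτ, hre x hx]
  refine ⟨k + LinearMap.id - h ∘ₗ k, fun x ↦ ?_, fun x hx ↦ ?_⟩
  · simpa using (SModEq.refl (k x + x)).sub (hh (k x))
  · simp [hk x hx]

theorem InverseMod.exists_leftInverseOn {f : P →ₗ[R] Q} {g : Q →ₗ[R] P} (h : InverseMod J f g)
    (hJ : J ≤ Ideal.jacobson ⊥) (D : SumRetract R P M) {X : Submodule R P} (hX : X.FG) :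
    ∃ g' : Q →ₗ[R] P, InverseMod J f g' ∧ ∀ x ∈ X, g' (f x) = x := by
  obtain ⟨k, hk, hkX⟩ := D.exists_leftInverseOn hJ (h := g ∘ₗ f) h.left hX
  exact ⟨k ∘ₗ g, ⟨fun x ↦ (hk _).trans (h.left x),
    fun y ↦ (smodEq_map_smul_top (hk _) f).trans (h.right y)⟩, hkX⟩

theorem InverseMod.nonempty_linearEquiv {I' : Type*} {M' : I' → Type*}
    [∀ i, AddCommGroup (M' i)] [∀ i, Module R (M' i)] [∀ i, Module.Finite R (M' i)]
    {f : P →ₗ[R] Q} {g : Q →ₗ[R] P} (h : InverseMod J f g) (hJ : J ≤ Ideal.jacobson ⊥)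
    (D : SumRetract R P M) (D' : SumRetract R Q M') (hP : IsCountablyGenerated R P)
    (hQ : IsCountablyGenerated R Q) : Nonempty (P ≃ₗ[R] Q) := by
  let S : Set (P →ₗ.[R] Q) := {θ | ∃ (f : P →ₗ[R] Q) (g : Q →ₗ[R] P) (X : Submodule R P),
    InverseMod J f g ∧ X.FG ∧ (∀ x ∈ X, g (f x) = x) ∧ f.toPMap X = θ}
  refine nonempty_linearEquiv_of_forth_of_back (S := S)
    ⟨f.toPMap ⊥, f, g, ⊥, h, Submodule.fg_bot, by simp, rfl⟩ ?_ ?_ ?_ hP hQ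
  · rintro _ ⟨f, g, X, -, -, hgf, rfl⟩ x y hxy
    have hxy' : g (f x) = g (f y) := congrArg g hxy
    rw [hgf x x.2, hgf y y.2] at hxy'
    exact Subtype.ext hxy'
  · rintro _ ⟨f, g, X, h, hX, -, rfl⟩ a
    have hX' : (X ⊔ R ∙ a).FG := hX.sup (Submodule.fg_span_singleton a)
    obtain ⟨g', h', hgf'⟩ := h.exists_leftInverseOn hJ D hX'
    exact ⟨f.toPMap (X ⊔ R ∙ a), ⟨f, g', _, h', hX', hgf', rfl⟩,
      ⟨le_sup_left, fun x y hxy ↦ congrArg f hxy⟩,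
      Submodule.mem_sup_right (Submodule.mem_span_singleton_self a)⟩
  · rintro _ ⟨f, g, X, h, hX, hgf, rfl⟩ b
    have hY : (X.map f ⊔ R ∙ b).FG := (hX.map f).sup (Submodule.fg_span_singleton b)
    obtain ⟨f', h', hfg'⟩ := h.symm.exists_leftInverseOn hJ D' hY
    refine ⟨f'.toPMap ((X.map f ⊔ R ∙ b).map g), ⟨f', g, _, h'.symm, hY.map g, ?_, rfl⟩,
      ⟨fun x hx ↦ ?_, fun x y hxy ↦ ?_⟩, ?_⟩
    · rintro _ ⟨y, hy, rfl⟩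
      rw [hfg' y hy]
    · rw [← hgf x hx]
      exact Submodule.mem_map_of_mem (Submodule.mem_sup_left (Submodule.mem_map_of_mem hx))
    · have hfx := hfg' (f x) (Submodule.mem_sup_left (Submodule.mem_map_of_mem x.2))
      rw [hgf x x.2, hxy] at hfx
      exact (congrArg f hxy).trans hfx.symm
    · have hb : b ∈ X.map f ⊔ R ∙ b :=
        Submodule.mem_sup_right (Submodule.mem_span_singleton_self b)
      exact ⟨⟨g b, Submodule.mem_map_of_mem hb⟩, hfg' b hb⟩

end InverseMod

section Approximation

variable {R : Type*} [CommRing R] {J : Ideal R} {A : Type*} [CommRing A] [Algebra R A]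
  {P Q : Type*} [AddCommGroup P] [Module R P] [AddCommGroup Q] [Module R Q]

/-- The `A`-linear map `α` is congruent to the base change of `h` modulo `J`. It is enough to ask
for this on the generators `1 ⊗ x` of `A ⊗ P`. -/
def IsApproximation (J : Ideal R) (α : A ⊗[R] P →ₗ[A] A ⊗[R] Q) (h : P →ₗ[R] Q) : Prop :=
  ∀ x, α (1 ⊗ₜ x) ≡ 1 ⊗ₜ h x [SMOD (J • ⊤ : Submodule R (A ⊗[R] Q))]

theorem smul_smodEq_smul {V : Type*} [AddCommGroup V] [Module R V] [Module A V]
    [IsScalarTower R A V] {a : A} {r : R} (ha : a - algebraMap R A r ∈ J.map (algebraMap R A))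
    {y z : V} (hyz : y ≡ z [SMOD (J • ⊤ : Submodule R V)]) :
    a • y ≡ r • z [SMOD (J • ⊤ : Submodule R V)] := by
  have hay : a ≡ algebraMap R A r [SMOD (J • ⊤ : Submodule R A)] := by
    rwa [SModEq.sub_mem, Ideal.smul_top_eq_map]
  have := smodEq_map_smul_top hay ((LinearMap.toSpanSingleton A V y).restrictScalars R)
  exact (by simpa using this : a • y ≡ r • y [SMOD (J • ⊤ : Submodule R V)]).trans (hyz.smul r)

theorem exists_isApproximation [Module.Flat R A] (ρ : A →ₐ[R] R ⧸ J)
    (hρ : RingHom.ker ρ ≤ J.map (algebraMap R A)) {N : Type*} [AddCommGroup N] [Module R N]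
    [Module.FinitePresentation R N] (α : A ⊗[R] N →ₗ[A] A ⊗[R] Q) :
    ∃ h : N →ₗ[R] Q, IsApproximation J α h := by
  induction α using (Module.FinitePresentation.isBaseChange_map R N Q A).inductionOn with
  | zero => exact ⟨0, fun x ↦ by simp⟩
  | tmul h => exact ⟨h, fun x ↦ by simp [LinearMap.baseChangeHom]⟩
  | smul a α ih =>
    obtain ⟨h, hh⟩ := ih
    obtain ⟨r, hr⟩ := Ideal.Quotient.mk_surjective (ρ a)
    have ha : a - algebraMap R A r ∈ J.map (algebraMap R A) :=
      hρ (by simp [RingHom.mem_ker, ← hr])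
    exact ⟨r • h, fun x ↦ by simpa using smul_smodEq_smul ha (hh x)⟩
  | add α β hα hβ =>
    obtain ⟨h, hh⟩ := hα
    obtain ⟨k, hk⟩ := hβ
    exact ⟨h + k, fun x ↦ by simpa [TensorProduct.tmul_add] using (hh x).add (hk x)⟩

theorem IsApproximation.comp {Z : Type*} [AddCommGroup Z] [Module R Z]
    {α : A ⊗[R] P →ₗ[A] A ⊗[R] Q} {β : A ⊗[R] Q →ₗ[A] A ⊗[R] Z} {f : P →ₗ[R] Q} {g : Q →ₗ[R] Z}
    (hβ : IsApproximation J β g) (hα : IsApproximation J α f) :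
    IsApproximation J (β ∘ₗ α) (g ∘ₗ f) :=
  fun x ↦ (smodEq_map_smul_top (hα x) (β.restrictScalars R)).trans (hβ (f x))

theorem smodEq_of_one_tmul_smodEq (ρ : A →ₐ[R] R ⧸ J) {x y : P}
    (h : (1 : A) ⊗ₜ[R] x ≡ 1 ⊗ₜ y [SMOD (J • ⊤ : Submodule R (A ⊗[R] P))]) :
    x ≡ y [SMOD (J • ⊤ : Submodule R P)] := by
  let θ : A ⊗[R] P →ₗ[R] P ⧸ (J • ⊤ : Submodule R P) :=
    (TensorProduct.quotTensorEquivQuotSMul P J).toLinearMap ∘ₗ ρ.toLinearMap.rTensor P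
  have hθ (z : P) : θ (1 ⊗ₜ z) = Submodule.Quotient.mk z := by
    simp only [θ, LinearMap.comp_apply, LinearMap.rTensor_tmul, AlgHom.toLinearMap_apply, map_one]
    simp
  have hker : (J • ⊤ : Submodule R (A ⊗[R] P)) ≤ θ.ker := by
    refine Submodule.smul_le.mpr fun r hr z _ ↦ ?_
    obtain ⟨y, hy⟩ := Submodule.mkQ_surjective _ (θ z)
    rw [LinearMap.mem_ker, map_smul, ← hy, ← map_smul, Submodule.mkQ_apply,
      Submodule.Quotient.mk_eq_zero]
    exact Submodule.smul_mem_smul hr Submodule.mem_top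
  have := LinearMap.sub_mem_ker_iff.mp (hker (SModEq.sub_mem.mp h))
  rwa [hθ, hθ] at this

theorem IsApproximation.inverseMod (ρ : A →ₐ[R] R ⧸ J) {Φ : A ⊗[R] P ≃ₗ[A] A ⊗[R] Q}
    {f : P →ₗ[R] Q} {g : Q →ₗ[R] P} (hf : IsApproximation J Φ.toLinearMap f)
    (hg : IsApproximation J Φ.symm.toLinearMap g) : InverseMod J f g where
  left x := smodEq_of_one_tmul_smodEq ρ <| by simpa using (hg.comp hf x).symm
  right y := smodEq_of_one_tmul_smodEq ρ <| by simpa using (hf.comp hg y).symm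

variable {I I' : Type*} {M : I → Type*} {M' : I' → Type*}
  [∀ i, AddCommGroup (M i)] [∀ i, Module R (M i)] [∀ i, Module.FinitePresentation R (M i)]
  [∀ i, AddCommGroup (M' i)] [∀ i, Module R (M' i)] [∀ i, Module.FinitePresentation R (M' i)]

theorem SumRetract.exists_isApproximation [Module.Flat R A] (D : SumRetract R P M)
    (ρ : A →ₐ[R] R ⧸ J) (hρ : RingHom.ker ρ ≤ J.map (algebraMap R A))
    (α : A ⊗[R] P →ₗ[A] A ⊗[R] Q) : ∃ h : P →ₗ[R] Q, IsApproximation J α h := by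
  choose φ hφ using fun i ↦ _root_.exists_isApproximation ρ hρ (α ∘ₗ (D.gen i).baseChange A)
  refine ⟨D.lift φ, fun x ↦ ?_⟩
  let π := (J • ⊤ : Submodule R (A ⊗[R] Q)).mkQ
  have hgen (i : I) : π ∘ₗ α.restrictScalars R ∘ₗ TensorProduct.mk R A P 1 ∘ₗ D.gen i =
      π ∘ₗ TensorProduct.mk R A Q 1 ∘ₗ φ i :=
    LinearMap.ext (hφ i)
  have hπ : π ∘ₗ α.restrictScalars R ∘ₗ TensorProduct.mk R A P 1 =
      π ∘ₗ TensorProduct.mk R A Q 1 ∘ₗ D.lift φ := by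
    rw [D.comp_lift, D.comp_lift, ← D.lift_comp_gen (π ∘ₗ _)]
    exact congrArg D.lift (funext hgen)
  exact LinearMap.congr_fun hπ x

theorem SumRetract.nonempty_linearEquiv_of_isCountablyGenerated [Module.Flat R A]
    (D : SumRetract R P M) (D' : SumRetract R Q M') (hJ : J ≤ Ideal.jacobson ⊥)
    (ρ : A →ₐ[R] R ⧸ J) (hρ : RingHom.ker ρ ≤ J.map (algebraMap R A))
    (hP : IsCountablyGenerated R P) (hQ : IsCountablyGenerated R Q)
    (Φ : A ⊗[R] P ≃ₗ[A] A ⊗[R] Q) : Nonempty (P ≃ₗ[R] Q) := by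
  obtain ⟨f, hf⟩ := D.exists_isApproximation ρ hρ Φ.toLinearMap
  obtain ⟨g, hg⟩ := D'.exists_isApproximation ρ hρ Φ.symm.toLinearMap
  exact (hf.inverseMod ρ hg).nonempty_linearEquiv hJ D D' hP hQ

end Approximation

section Layer

/-- For idempotent endomorphisms with `range p ≤ range q`, an idempotent whose range is a complement
of `range p` in `range q`. -/
def layer {E : Type*} [Ring E] (p q : E) : E :=
  (1 - p) * q

variable {E : Type*} [Ring E] {p q s t : E}

theorem mul_layer_self (hp : p * p = p) : p * layer p q = 0 := by
  rw [layer, ← mul_assoc, mul_sub, mul_one, hp, sub_self, zero_mul]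

theorem mul_layer (hqp : q * p = p) (htq : t * q = q) : t * layer p q = layer p q := by
  have htp : t * p = p := by rw [← hqp, ← mul_assoc, htq]
  rw [layer, ← mul_assoc, mul_sub, mul_one, htp, sub_mul, sub_mul, one_mul, htq]

theorem layer_mul_eq_zero (hqp : q * p = p) (hps : p * s = s) : layer p q * s = 0 := by
  have hqs : q * s = s := by rw [← hps, ← mul_assoc, hqp]
  rw [layer, mul_assoc, hqs, sub_mul, one_mul, hps, sub_self]

theorem layer_mul_layer (hp : p * p = p) (hq : q * q = q) (hqp : q * p = p) :
    layer p q * layer p q = layer p q := by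
  nth_rw 1 [layer]
  rw [mul_assoc, mul_layer hqp hq, sub_mul, one_mul, mul_layer_self hp, sub_zero]

theorem layer_mul_layer_mul_layer (hp : p * p = p) (hq : q * q = q) (hqp : q * p = p)
    (hps : p * s = s) (htq : t * q = q) : layer p q * (layer s t * layer p q) = layer p q := by
  nth_rw 2 [layer]
  rw [mul_assoc, mul_layer hqp htq, sub_mul, one_mul, mul_sub, ← mul_assoc,
    layer_mul_eq_zero hqp hps, zero_mul, sub_zero, layer_mul_layer hp hq hqp]

variable {R : Type*} [CommRing R] {P : Type*} [AddCommGroup P] [Module R P]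

theorem range_sup_range_layer {p q : Module.End R P} (hq : q * q = q) (hqp : q * p = p) :
    p.range ⊔ (layer p q).range = q.range := by
  have range_le {f : Module.End R P} (hf : q * f = f) : f.range ≤ q.range :=
    hf ▸ LinearMap.range_comp_le_range f q
  refine le_antisymm (sup_le (range_le hqp) (range_le (mul_layer hqp hq))) ?_
  rintro _ ⟨x, rfl⟩
  have hx : p (q x) + layer p q x = q x := by simp [layer]
  exact hx ▸ Submodule.add_mem_sup (LinearMap.mem_range_self p _) (LinearMap.mem_range_self _ x)

theorem disjoint_range_range_layer {p q : Module.End R P} (hp : p * p = p) :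
    Disjoint p.range (layer p q).range := by
  refine Submodule.disjoint_def.mpr ?_
  rintro _ ⟨x, rfl⟩ ⟨y, hy⟩
  calc p x = (p * p) x := by rw [hp]
    _ = (p * layer p q) y := by rw [Module.End.mul_apply, ← hy, Module.End.mul_apply]
    _ = 0 := by rw [mul_layer_self hp, LinearMap.zero_apply]

variable {Q : Type*} [AddCommGroup Q] [Module R Q]

theorem rangeRestrict_comp_subtype {ε : Module.End R P} (hε : ε * ε = ε) :
    ε.rangeRestrict ∘ₗ ε.range.subtype = LinearMap.id :=
  LinearMap.ext fun x ↦ Subtype.ext ((LinearMap.IsIdempotentElem.mem_range_iff hε).mp x.2)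

theorem nonempty_linearEquiv_of_retracts {K K' : Type*} [AddCommGroup K] [Module R K]
    [AddCommGroup K'] [Module R K'] {j : K →ₗ[R] P} {κ : P →ₗ[R] K} {j' : K' →ₗ[R] Q}
    {κ' : Q →ₗ[R] K'} (hκj : κ ∘ₗ j = LinearMap.id) (hκj' : κ' ∘ₗ j' = LinearMap.id)
    (Φ : P ≃ₗ[R] Q)
    (h : (j ∘ₗ κ) ∘ₗ Φ.symm.toLinearMap ∘ₗ (j' ∘ₗ κ') ∘ₗ Φ.toLinearMap ∘ₗ j ∘ₗ κ = j ∘ₗ κ)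
    (h' : (j' ∘ₗ κ') ∘ₗ Φ.toLinearMap ∘ₗ (j ∘ₗ κ) ∘ₗ Φ.symm.toLinearMap ∘ₗ j' ∘ₗ κ' = j' ∘ₗ κ') :
    Nonempty (K ≃ₗ[R] K') := by
  replace hκj := LinearMap.congr_fun hκj
  replace hκj' := LinearMap.congr_fun hκj'
  simp only [LinearMap.comp_apply, LinearMap.id_apply] at hκj hκj'
  refine ⟨LinearEquiv.ofLinearMap (κ' ∘ₗ Φ.toLinearMap ∘ₗ j) (κ ∘ₗ Φ.symm.toLinearMap ∘ₗ j')
    (LinearMap.ext fun z ↦ ?_) (LinearMap.ext fun z ↦ ?_)⟩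
  · simpa [hκj, hκj'] using congrArg κ' (LinearMap.congr_fun h' (j' z))
  · simpa [hκj, hκj'] using congrArg κ (LinearMap.congr_fun h (j z))

theorem baseChange_rangeRestrict_comp_subtype (A : Type*) [CommRing A] [Algebra R A]
    {ε : Module.End R P} (hε : ε * ε = ε) :
    ε.rangeRestrict.baseChange A ∘ₗ ε.range.subtype.baseChange A = LinearMap.id := by
  rw [← LinearMap.baseChange_comp, rangeRestrict_comp_subtype hε, LinearMap.baseChange_id]

theorem baseChange_eq_subtype_comp_rangeRestrict (A : Type*) [CommRing A] [Algebra R A]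
    (ε : Module.End R P) :
    ε.baseChange A = ε.range.subtype.baseChange A ∘ₗ ε.rangeRestrict.baseChange A :=
  LinearMap.baseChange_comp ε.rangeRestrict ε.range.subtype

theorem nonempty_baseChange_range_equiv {A : Type*} [CommRing A] [Algebra R A]
    {ε : Module.End R P} {ε' : Module.End R Q} (hε : ε * ε = ε) (hε' : ε' * ε' = ε')
    (Φ : A ⊗[R] P ≃ₗ[A] A ⊗[R] Q)
    (h : ε.baseChange A ∘ₗ Φ.symm.toLinearMap ∘ₗ ε'.baseChange A ∘ₗ Φ.toLinearMap ∘ₗ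
      ε.baseChange A = ε.baseChange A)
    (h' : ε'.baseChange A ∘ₗ Φ.toLinearMap ∘ₗ ε.baseChange A ∘ₗ Φ.symm.toLinearMap ∘ₗ
      ε'.baseChange A = ε'.baseChange A) :
    Nonempty (A ⊗[R] ε.range ≃ₗ[A] A ⊗[R] ε'.range) := by
  rw [baseChange_eq_subtype_comp_rangeRestrict A ε, baseChange_eq_subtype_comp_rangeRestrict A ε']
    at h h'
  exact nonempty_linearEquiv_of_retracts (baseChange_rangeRestrict_comp_subtype A hε)
    (baseChange_rangeRestrict_comp_subtype A hε') Φ h h'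

end Layer

section Filtration

theorem isInternal_of_filtration {R P W : Type*} [CommRing R] [AddCommGroup P] [Module R P]
    [LinearOrder W] [WellFoundedLT W] {V K : W → Submodule R P}
    (hsup : ∀ w, (⨆ v < w, V v) ⊔ K w = V w) (hdisj : ∀ w, Disjoint (⨆ v < w, V v) (K w))
    (htop : ⨆ w, V w = ⊤) : DirectSum.IsInternal K := by
  apply DirectSum.isInternal_submodule_of_iSupIndep_of_iSup_eq_top
  · rw [iSupIndep_iff_finsetSum_eq_zero_imp_eq_zero]
    intro s x hx hsum
    induction s using Finset.induction_on_max with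
    | empty => simp
    | insert a s ha ih =>
      rw [Finset.sum_insert fun h ↦ lt_irrefl a (ha a h)] at hsum
      have hlt : ∀ i ∈ s, x i ∈ ⨆ v < a, V v := fun i hi ↦
        (le_sup_right.trans (hsup i).le).trans (le_iSup₂_of_le i (ha i hi) le_rfl)
          (hx i (Finset.mem_insert_of_mem hi))
      have hxa : x a = 0 := by
        refine Submodule.disjoint_def.mp (hdisj a) _ ?_ (hx a (Finset.mem_insert_self a s))
        rw [eq_neg_of_add_eq_zero_left hsum]
        exact neg_mem (sum_mem hlt)
      rw [hxa, zero_add] at hsum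
      rw [Finset.forall_mem_insert]
      exact ⟨hxa, ih (fun j hj ↦ hx j (Finset.mem_insert_of_mem hj)) hsum⟩
  · rw [← top_le_iff, ← htop]
    refine iSup_le fun w ↦ ?_
    induction w using WellFoundedLT.induction with
    | ind w ih => exact (hsup w).ge.trans (sup_le (iSup₂_le ih) (le_iSup K w))

theorem countable_setOf_reflTransGen {B : Type*} {r : B → B → Prop}
    (hr : ∀ a, {b | r a b}.Countable) (a : B) : {b | Relation.ReflTransGen r a b}.Countable := by
  let step : ℕ → Set B := fun n ↦ Nat.rec {a} (fun _ s ↦ ⋃ x ∈ s, {b | r x b}) n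
  have hstep : ∀ n, (step n).Countable := fun n ↦ by
    induction n with
    | zero => exact Set.countable_singleton a
    | succ n ih => exact ih.biUnion fun x _ ↦ hr x
  refine (Set.countable_iUnion hstep).mono fun b hb ↦ ?_
  induction hb with
  | refl => exact Set.mem_iUnion.mpr ⟨0, rfl⟩
  | tail _ hbc ih =>
    obtain ⟨n, hn⟩ := Set.mem_iUnion.mp ih
    exact Set.mem_iUnion.mpr ⟨n + 1, Set.mem_biUnion hn hbc⟩

/-- A set that contains all `r`-successors of its elements. -/
def IsClosedUnder {B : Type*} (r : B → B → Prop) (C : Set B) : Prop :=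
  ∀ ⦃a b⦄, a ∈ C → r a b → b ∈ C

theorem IsClosedUnder.biUnion_lt {B W : Type*} [LT W] {r : B → B → Prop} {C : W → Set B}
    (hC : ∀ w, IsClosedUnder r (C w)) (w : W) : IsClosedUnder r (⋃ v < w, C v) := by
  intro a b ha hab
  obtain ⟨v, hv, ha⟩ := Set.mem_iUnion₂.mp ha
  exact Set.mem_iUnion₂.mpr ⟨v, hv, hC v ha hab⟩

theorem exists_filtration_isClosedUnder {B : Type*} {r : B → B → Prop}
    (hr : ∀ a, {b | r a b}.Countable) :
    ∃ (_ : LinearOrder B) (_ : WellFoundedLT B) (C : B → Set B), Monotone C ∧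
      (∀ w, IsClosedUnder r (C w)) ∧ (∀ w, (C w \ ⋃ v < w, C v).Countable) ∧
      ⋃ w, C w = Set.univ := by
  obtain ⟨hlin, hwf⟩ := exists_wellFoundedLT B
  refine ⟨hlin, hwf, fun w ↦ {b | ∃ v ≤ w, Relation.ReflTransGen r v b}, ?_, ?_, fun w ↦ ?_, ?_⟩
  · exact fun w w' hw b ⟨v, hv, hb⟩ ↦ ⟨v, hv.trans hw, hb⟩
  · exact fun w a b ⟨v, hv, ha⟩ hab ↦ ⟨v, hv, ha.tail hab⟩
  · refine (countable_setOf_reflTransGen hr w).mono ?_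
    rintro b ⟨⟨v, hv, hb⟩, hlt⟩
    obtain rfl | hv := hv.eq_or_lt
    · exact hb
    · exact (hlt (Set.mem_iUnion₂.mpr ⟨v, hv, v, le_rfl, hb⟩)).elim
  · exact Set.iUnion_eq_univ_iff.mpr fun b ↦ ⟨b, b, le_rfl, .refl⟩

end Filtration

section Kaplansky

namespace SumRetract

variable {R : Type*} [CommRing R] {P Q : Type*} [AddCommGroup P] [Module R P]
  [AddCommGroup Q] [Module R Q] {I I' : Type*} {M : I → Type*} {M' : I' → Type*}
  [∀ i, AddCommGroup (M i)] [∀ i, Module R (M i)] [∀ i, AddCommGroup (M' i)] [∀ i, Module R (M' i)]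
  (D : SumRetract R P M) (D' : SumRetract R Q M')

open Classical in
/-- The endomorphism of `P` obtained from `∑ᶠ i, gen i ∘ coord i` by keeping the summands in `S`.
It is idempotent when `S` is stable in the sense of `MapsInto`. -/
noncomputable def proj (S : Set I) : Module.End R P :=
  D.lift (S.piecewise D.gen 0)

/-- The elements of `I ⊕ I'` stand for the summands of `P` and of `Q`. One of them is linked to
those that its image under the identity, under `Φ` or under `Φ⁻¹` meets. -/
def Linked {A : Type*} [CommRing A] [Algebra R A] (Φ : A ⊗[R] P ≃ₗ[A] A ⊗[R] Q) :
    I ⊕ I' → I ⊕ I' → Prop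
  | .inl i, .inl j => j ∈ D.support (D.gen i)
  | .inl i, .inr l => l ∈ (D'.baseChange A).support (Φ.toLinearMap ∘ₗ (D.baseChange A).gen i)
  | .inr k, .inl j => j ∈ (D.baseChange A).support (Φ.symm.toLinearMap ∘ₗ (D'.baseChange A).gen k)
  | .inr k, .inr l => l ∈ D'.support (D'.gen k)

/-- The map `φ` sends the summands of `P` with index in `S` into those of `Q` with index in `S'`.
For `φ = id` and `S = S'` this says that the idempotent `coord ∘ gen` of the direct sum preserves
the summands in `S`. -/
def MapsInto (φ : P →ₗ[R] Q) (S : Set I) (S' : Set I') : Prop :=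
  ∀ i ∈ S, D'.support (φ ∘ₗ D.gen i) ⊆ S'

variable {D D'} {S T : Set I} {S' T' : Set I'}

open Classical in
theorem proj_comp_of_support_subset {N : Type*} [AddCommGroup N] [Module R N] {φ : N →ₗ[R] P}
    (h : D.support φ ⊆ S) : D.proj S ∘ₗ φ = φ := by
  refine LinearMap.ext fun x ↦ ?_
  rw [LinearMap.comp_apply, proj, lift_apply]
  nth_rw 2 [← D.finsum_gen_coord (φ x)]
  refine finsum_congr fun i ↦ ?_
  by_cases hi : i ∈ S
  · rw [S.piecewise_eq_of_mem _ _ hi]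
  · rw [D.coord_eq_zero_of_notMem_support (fun hφ ↦ hi (h hφ)), map_zero, map_zero]

theorem comp_proj_eq_comp_proj {Z : Type*} [AddCommGroup Z] [Module R Z] {φ ψ : P →ₗ[R] Z}
    (h : ∀ i ∈ S, φ ∘ₗ D.gen i = ψ ∘ₗ D.gen i) : φ ∘ₗ D.proj S = ψ ∘ₗ D.proj S := by
  rw [proj, comp_lift, comp_lift]
  refine congrArg D.lift (funext fun i ↦ ?_)
  by_cases hi : i ∈ S
  · simpa [hi] using h i hi
  · simp [hi]

theorem MapsInto.mono_right {φ : P →ₗ[R] Q} {S'' : Set I'} (h : D.MapsInto D' φ S S')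
    (hS : S' ⊆ S'') : D.MapsInto D' φ S S'' :=
  fun i hi ↦ (h i hi).trans hS

theorem MapsInto.proj_comp {φ : P →ₗ[R] Q} (h : D.MapsInto D' φ S S') :
    D'.proj S' ∘ₗ φ ∘ₗ D.proj S = φ ∘ₗ D.proj S :=
  comp_proj_eq_comp_proj (φ := D'.proj S' ∘ₗ φ) fun i hi ↦
    proj_comp_of_support_subset (φ := φ ∘ₗ D.gen i) (h i hi)

theorem MapsInto.proj_mul_proj (h : D.MapsInto D .id S T) : D.proj T * D.proj S = D.proj S :=
  h.proj_comp

theorem MapsInto.proj_comp_gen (h : D.MapsInto D .id S S) {i : I} (hi : i ∈ S) :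
    D.proj S ∘ₗ D.gen i = D.gen i :=
  proj_comp_of_support_subset (h i hi)

theorem MapsInto.biUnion_lt {W : Type*} [LT W] {T : W → Set I}
    (h : ∀ w, D.MapsInto D .id (T w) (T w)) (w : W) :
    D.MapsInto D .id (⋃ v < w, T v) (⋃ v < w, T v) := by
  intro i hi
  obtain ⟨v, hv, hi⟩ := Set.mem_iUnion₂.mp hi
  exact (h v i hi).trans (Set.subset_biUnion_of_mem (u := T) hv)

theorem range_lift_le {φ : ∀ i, M i →ₗ[R] Q} {K : Submodule R Q} (h : ∀ i, (φ i).range ≤ K) :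
    (D.lift φ).range ≤ K := by
  rintro _ ⟨x, rfl⟩
  exact finsum_induction (· ∈ K) K.zero_mem (fun _ _ ↦ K.add_mem) fun i ↦
    h i (LinearMap.mem_range_self _ _)

theorem range_proj_le {K : Submodule R P} (h : ∀ i ∈ S, (D.gen i).range ≤ K) :
    (D.proj S).range ≤ K :=
  range_lift_le fun i ↦ by by_cases hi : i ∈ S <;> simp [hi, h]

theorem MapsInto.range_gen_le (h : D.MapsInto D .id S S) {i : I} (hi : i ∈ S) :
    (D.gen i).range ≤ (D.proj S).range :=
  h.proj_comp_gen hi ▸ LinearMap.range_comp_le_range _ _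

theorem proj_univ : D.proj Set.univ = 1 := by
  rw [proj, Set.piecewise_univ]
  exact D.lift_comp_gen LinearMap.id

section Decomposition

variable {W : Type*} [LinearOrder W] {T : W → Set I}

theorem iSup_range_proj (h : ∀ w, D.MapsInto D .id (T w) (T w)) (w : W) :
    ⨆ v < w, (D.proj (T v)).range = (D.proj (⋃ v < w, T v)).range := by
  refine le_antisymm (iSup₂_le fun v hv ↦ range_proj_le fun i hi ↦ ?_)
    (range_proj_le fun i hi ↦ ?_)
  · exact (MapsInto.biUnion_lt h w).range_gen_le (Set.mem_biUnion hv hi)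
  · obtain ⟨v, hv, hi⟩ := Set.mem_iUnion₂.mp hi
    exact ((h v).range_gen_le hi).trans (le_iSup₂_of_le v hv le_rfl)

theorem isInternal_range_layer [WellFoundedLT W] (hmono : Monotone T)
    (h : ∀ w, D.MapsInto D .id (T w) (T w)) (htop : ⋃ w, T w = Set.univ) :
    DirectSum.IsInternal fun w ↦ (layer (D.proj (⋃ v < w, T v)) (D.proj (T w))).range := by
  have hlt := MapsInto.biUnion_lt h
  have hsub (w : W) : ⋃ v < w, T v ⊆ T w := Set.iUnion₂_subset fun v hv ↦ hmono hv.le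
  refine isInternal_of_filtration (V := fun w ↦ (D.proj (T w)).range) (fun w ↦ ?_) (fun w ↦ ?_) ?_
  · rw [iSup_range_proj h]
    exact range_sup_range_layer (h w).proj_mul_proj ((hlt w).mono_right (hsub w)).proj_mul_proj
  · rw [iSup_range_proj h]
    exact disjoint_range_range_layer (hlt w).proj_mul_proj
  · rw [← top_le_iff, ← LinearMap.range_id, ← Module.End.one_eq_id, ← D.proj_univ]
    refine range_proj_le fun i _ ↦ ?_
    obtain ⟨w, hi⟩ := Set.iUnion_eq_univ_iff.mp htop i
    exact ((h w).range_gen_le hi).trans (le_iSup_of_le w le_rfl)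

end Decomposition

theorem isCountablyGenerated_of_surjective_lift [∀ i, Module.Finite R (M i)] {φ : ∀ i, M i →ₗ[R] Q}
    (hφ : Function.Surjective (D.lift φ)) {U : Set I} (hU : U.Countable)
    (h : ∀ i ∉ U, φ i = 0) : IsCountablyGenerated R Q := by
  choose s hs using fun i ↦ Module.Finite.fg_top (R := R) (M := M i)
  refine ⟨⋃ i ∈ U, φ i '' s i, hU.biUnion fun i _ ↦ (s i).countable_toSet.image _, ?_⟩
  rw [← top_le_iff, ← LinearMap.range_eq_top.mpr hφ]
  refine range_lift_le fun i ↦ ?_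
  by_cases hi : i ∈ U
  · rw [LinearMap.range_eq_map, ← hs i, Submodule.map_span]
    exact Submodule.span_mono (Set.subset_biUnion_of_mem (u := fun i ↦ φ i '' s i) hi)
  · simp [h i hi]

open Classical in
theorem isCountablyGenerated_range_layer [∀ i, Module.Finite R (M i)] (hST : S ⊆ T)
    (hS : D.MapsInto D .id S S) (hT : D.MapsInto D .id T T) (hcount : (T \ S).Countable) :
    IsCountablyGenerated R (layer (D.proj S) (D.proj T)).range := by
  let κ := (layer (D.proj S) (D.proj T)).rangeRestrict
  have hκ : D.lift (fun i ↦ κ ∘ₗ (1 - D.proj S) ∘ₗ T.piecewise D.gen 0 i) = κ := by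
    rw [← comp_lift, ← comp_lift]
    exact LinearMap.ext fun x ↦ Subtype.ext <| LinearMap.congr_fun (layer_mul_layer
      hS.proj_mul_proj hT.proj_mul_proj (hS.mono_right hST).proj_mul_proj) x
  have hsurj : Function.Surjective κ := LinearMap.surjective_rangeRestrict _
  rw [← hκ] at hsurj
  refine isCountablyGenerated_of_surjective_lift hsurj hcount fun i hi ↦ ?_
  by_cases hiT : i ∈ T
  · have hgen : (1 - D.proj S) ∘ₗ D.gen i = 0 := by
      rw [LinearMap.sub_comp, hS.proj_comp_gen (by_contra fun hiS ↦ hi ⟨hiT, hiS⟩)]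
      exact sub_self _
    rw [T.piecewise_eq_of_mem _ _ hiT, hgen, LinearMap.comp_zero]
  · simp [hiT]

variable {A : Type*} [CommRing A] [Algebra R A]

theorem baseChange_proj (S : Set I) : (D.proj S).baseChange A = (D.baseChange A).proj S := by
  rw [proj, proj, baseChange_lift]
  refine congrArg (D.baseChange A).lift (funext fun i ↦ ?_)
  by_cases hi : i ∈ S <;> simp [hi, baseChange]

theorem baseChange_layer_comp {Φ : A ⊗[R] P ≃ₗ[A] A ⊗[R] Q} (hST : S ⊆ T)
    (hS : D.MapsInto D .id S S) (hT : D.MapsInto D .id T T)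
    (hΦ : (D.baseChange A).MapsInto (D'.baseChange A) Φ.toLinearMap T T')
    (hΦ' : (D'.baseChange A).MapsInto (D.baseChange A) Φ.symm.toLinearMap S' S) :
    (layer (D.proj S) (D.proj T)).baseChange A ∘ₗ Φ.symm.toLinearMap ∘ₗ
      (layer (D'.proj S') (D'.proj T')).baseChange A ∘ₗ Φ.toLinearMap ∘ₗ
        (layer (D.proj S) (D.proj T)).baseChange A =
      (layer (D.proj S) (D.proj T)).baseChange A := by
  let β := (Module.End.baseChangeHom R A P).toRingHom
  let γ := Φ.symm.conjRingEquiv.toRingHom.comp (Module.End.baseChangeHom R A Q).toRingHom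
  have hΦβ : γ (D'.proj T') * β (D.proj T) = β (D.proj T) := by
    have := hΦ.proj_comp
    rw [← baseChange_proj, ← baseChange_proj] at this
    exact LinearMap.ext fun z ↦
      Φ.symm_apply_eq.mpr (LinearMap.congr_fun this z)
  have hΦγ : β (D.proj S) * γ (D'.proj S') = γ (D'.proj S') := by
    have := hΦ'.proj_comp
    rw [← baseChange_proj, ← baseChange_proj] at this
    exact LinearMap.ext fun z ↦ LinearMap.congr_fun this (Φ z)
  have := layer_mul_layer_mul_layer (p := β (D.proj S)) (q := β (D.proj T))
    (by rw [← map_mul, hS.proj_mul_proj]) (by rw [← map_mul, hT.proj_mul_proj])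
    (by rw [← map_mul, (hS.mono_right hST).proj_mul_proj]) hΦγ hΦβ
  have hβ : β (layer (D.proj S) (D.proj T)) = layer (β (D.proj S)) (β (D.proj T)) :=
    by simp only [layer, map_mul, map_sub, map_one]
  have hγ : γ (layer (D'.proj S') (D'.proj T')) = layer (γ (D'.proj S')) (γ (D'.proj T')) :=
    by simp only [layer, map_mul, map_sub, map_one]
  rw [← hβ, ← hγ] at this
  exact this

theorem countable_setOf_linked [∀ i, Module.Finite R (M i)] [∀ i, Module.Finite R (M' i)]
    (Φ : A ⊗[R] P ≃ₗ[A] A ⊗[R] Q) (a : I ⊕ I') : {b | D.Linked D' Φ a b}.Countable := by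
  refine (Set.finite_preimage_inl_and_inr.mp ?_).countable
  cases a with
  | inl i => exact ⟨D.finite_support _, (D'.baseChange A).finite_support _⟩
  | inr i' => exact ⟨(D.baseChange A).finite_support _, D'.finite_support _⟩

section IsClosedUnder

variable {Φ : A ⊗[R] P ≃ₗ[A] A ⊗[R] Q} {C C₀ : Set (I ⊕ I')}

theorem mapsInto_left (hC : IsClosedUnder (D.Linked D' Φ) C) :
    D.MapsInto D .id (Sum.inl ⁻¹' C) (Sum.inl ⁻¹' C) :=
  fun _ hi _ hj ↦ hC hi hj

theorem mapsInto_right (hC : IsClosedUnder (D.Linked D' Φ) C) :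
    D'.MapsInto D' .id (Sum.inr ⁻¹' C) (Sum.inr ⁻¹' C) :=
  fun _ hi _ hj ↦ hC hi hj

theorem mapsInto_equiv (hC : IsClosedUnder (D.Linked D' Φ) C) :
    (D.baseChange A).MapsInto (D'.baseChange A) Φ.toLinearMap (Sum.inl ⁻¹' C) (Sum.inr ⁻¹' C) :=
  fun _ hi _ hj ↦ hC hi hj

theorem mapsInto_symm (hC : IsClosedUnder (D.Linked D' Φ) C) :
    (D'.baseChange A).MapsInto (D.baseChange A) Φ.symm.toLinearMap
      (Sum.inr ⁻¹' C) (Sum.inl ⁻¹' C) :=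
  fun _ hi _ hj ↦ hC hi hj

variable {J : Ideal R} [Module.Flat R A] [∀ i, Module.FinitePresentation R (M i)]
  [∀ i, Module.FinitePresentation R (M' i)]

theorem nonempty_range_layer_equiv (hJ : J ≤ Ideal.jacobson ⊥) (ρ : A →ₐ[R] R ⧸ J)
    (hρ : RingHom.ker ρ ≤ J.map (algebraMap R A)) (hC₀ : IsClosedUnder (D.Linked D' Φ) C₀)
    (hC : IsClosedUnder (D.Linked D' Φ) C) (hsub : C₀ ⊆ C) (hcount : (C \ C₀).Countable) :
    Nonempty ((layer (D.proj (Sum.inl ⁻¹' C₀)) (D.proj (Sum.inl ⁻¹' C))).range ≃ₗ[R]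
      (layer (D'.proj (Sum.inr ⁻¹' C₀)) (D'.proj (Sum.inr ⁻¹' C))).range) := by
  have hε := layer_mul_layer (mapsInto_left hC₀).proj_mul_proj (mapsInto_left hC).proj_mul_proj
    ((mapsInto_left hC₀).mono_right (Set.preimage_mono hsub)).proj_mul_proj
  have hε' := layer_mul_layer (mapsInto_right hC₀).proj_mul_proj (mapsInto_right hC).proj_mul_proj
    ((mapsInto_right hC₀).mono_right (Set.preimage_mono hsub)).proj_mul_proj
  obtain ⟨Ψ⟩ := nonempty_baseChange_range_equiv hε hε' Φ
    (baseChange_layer_comp (Set.preimage_mono hsub) (mapsInto_left hC₀) (mapsInto_left hC)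
      (mapsInto_equiv hC) (mapsInto_symm hC₀))
    (baseChange_layer_comp (Φ := Φ.symm) (Set.preimage_mono hsub) (mapsInto_right hC₀)
      (mapsInto_right hC) (mapsInto_symm hC) (mapsInto_equiv hC₀))
  exact (D.retract _ _ (rangeRestrict_comp_subtype hε)).nonempty_linearEquiv_of_isCountablyGenerated
    (D'.retract _ _ (rangeRestrict_comp_subtype hε')) hJ ρ hρ
    (isCountablyGenerated_range_layer (Set.preimage_mono hsub) (mapsInto_left hC₀)
      (mapsInto_left hC) (hcount.preimage Sum.inl_injective))
    (isCountablyGenerated_range_layer (Set.preimage_mono hsub) (mapsInto_right hC₀)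
      (mapsInto_right hC) (hcount.preimage Sum.inr_injective)) Ψ

end IsClosedUnder

theorem nonempty_linearEquiv {J : Ideal R} [Module.Flat R A]
    [∀ i, Module.FinitePresentation R (M i)] [∀ i, Module.FinitePresentation R (M' i)]
    (D : SumRetract R P M) (D' : SumRetract R Q M') (hJ : J ≤ Ideal.jacobson ⊥)
    (ρ : A →ₐ[R] R ⧸ J) (hρ : RingHom.ker ρ ≤ J.map (algebraMap R A))
    (Φ : A ⊗[R] P ≃ₗ[A] A ⊗[R] Q) : Nonempty (P ≃ₗ[R] Q) := by
  obtain ⟨_, _, C, hmono, hC, hcount, htop⟩ :=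
    exists_filtration_isClosedUnder (countable_setOf_linked (D := D) (D' := D') Φ)
  have hsub (w) : ⋃ v < w, C v ⊆ C w := Set.iUnion₂_subset fun v hv ↦ hmono hv.le
  have hinl := isInternal_range_layer (D := D) (T := fun w ↦ Sum.inl ⁻¹' C w)
    (fun _ _ h ↦ Set.preimage_mono (hmono h)) (fun w ↦ mapsInto_left (hC w))
    (by rw [← Set.preimage_iUnion, htop, Set.preimage_univ])
  have hinr := isInternal_range_layer (D := D') (T := fun w ↦ Sum.inr ⁻¹' C w)
    (fun _ _ h ↦ Set.preimage_mono (hmono h)) (fun w ↦ mapsInto_right (hC w))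
    (by rw [← Set.preimage_iUnion, htop, Set.preimage_univ])
  simp only [← Set.preimage_iUnion₂] at hinl hinr
  have hlayer (w) := nonempty_range_layer_equiv hJ ρ hρ (IsClosedUnder.biUnion_lt hC w) (hC w)
    (hsub w) (hcount w)
  exact ⟨(LinearEquiv.ofBijective (DirectSum.coeLinearMap _) hinl).symm ≪≫ₗ
    DirectSum.congrLinearEquiv (fun w ↦ (hlayer w).some) ≪≫ₗ
    LinearEquiv.ofBijective (DirectSum.coeLinearMap _) hinr⟩

end SumRetract

end Kaplansky

/-- The data `ρ` and `hρ` say that `R ⧸ J → A ⧸ J A` is an isomorphism. -/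
theorem mainTheorem2_general {R : Type u} [CommRing R] {J : Ideal R} (hJ : J ≤ Ideal.jacobson ⊥)
    {A : Type*} [CommRing A] [Algebra R A] [Module.Flat R A] (ρ : A →ₐ[R] R ⧸ J)
    (hρ : RingHom.ker ρ ≤ J.map (algebraMap R A)) {P : Type v} {Q : Type w} [AddCommGroup P]
    [Module R P] [AddCommGroup Q] [Module R Q] (hP : IsPureProjective R P)
    (hQ : IsPureProjective R Q) :
    Nonempty (P ≃ₗ[R] Q) ↔ Nonempty (A ⊗[R] P ≃ₗ[A] A ⊗[R] Q) := by
  refine ⟨fun ⟨e⟩ ↦ ⟨e.baseChange R A P Q⟩, fun ⟨Φ⟩ ↦ ?_⟩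
  obtain ⟨D⟩ := hP.nonempty_sumRetract
  obtain ⟨D'⟩ := hQ.nonempty_sumRetract
  exact D.nonempty_linearEquiv D' hJ ρ hρ Φ

theorem mainTheorem2 (R : Type u) [CommRing R] [IsLocalRing R] [IsNoetherianRing R]
    (P : Type v) [AddCommGroup P] [Module R P] (Q : Type w) [AddCommGroup Q] [Module R Q]
    (hP : IsPureProjective R P) (hQ : IsPureProjective R Q) :
    Nonempty (P ≃ₗ[R] Q) ↔
      Nonempty ((LocalCompletion R ⊗[R] P) ≃ₗ[LocalCompletion R] (LocalCompletion R ⊗[R] Q)) :=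
  mainTheorem2_general (IsLocalRing.maximalIdeal_le_jacobson ⊥) (AdicCompletion.evalOneₐ _)
    (AdicCompletion.ker_evalOneₐ_eq_map _ (IsNoetherian.noetherian _)).le hP hQ
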